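/- Let $k\ge 2$ be an integer not divisible by $4$, and let $H$ be a finite connected $k$-uniform hypergraph with vertex set $V$ and with at least one edge. (Here $H$ is $k$-uniform if every edge is a set of exactly $k$ distinct vertices, and connected if any two vertices are joined by a sequence of vertices in which consecutive ones lie in a common edge.) The adjacency tensor $\mathcal{A}_H=(a_{i_1\cdots i_k})$, indexed by $i_1,\dots,i_k\in V$, has $a_{i_1\cdots i_k}=\frac{1}{(k-1)!}$ if $\{i_1,\dots,i_k\}$ is an edge of $H$, and $a_{i_1\cdots i_k}=0$ otherwise. A number $\lambda\in\mathbb{C}$ is an eigenvalue of $H$ if there is a nonzero vector $x\in\mathbb{C}^V$ such that $$\sum_{i_2,\dots,i_k\in V}a_{ii_2\cdots i_k}x_{i_2}\cdots x_{i_k}=\lambda x_i^{k-1}\qquad\text{for all } i\in V,$$ and $\rho(\mathcal{A}_H)$ denotes the maximal modulus of the eigenvalues of $H$. The hypergraph $H$ is odd-bipartite if there is a proper subset $V_1$ of $V$ such that every edge of $H$ contains an odd number of vertices of $V_1$. Then the following are equivalent: (1) $k$ is even and $H$ is odd-bipartite; (2) $-\rho(\mathcal{A}_H)$ is an eigenvalue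 of $H$. -/

import Mathlib

/-- A complex tensor of order `k ≥ 2` with indices in `ι`. The entry `a_{i i₂ ⋯ i_k}` is `A i y`,
where `y = (i₂, …, i_k)`. -/
abbrev CubicalTensor (ι : Type*) (k : ℕ) : Type _ := ι → (Fin (k - 1) → ι) → ℂ

namespace CubicalTensor

variable {ι : Type*} [Fintype ι] {k : ℕ}

/-- The vector `A x`, `(A x)_i = ∑_{i₂, …, i_k} a_{i i₂ ⋯ i_k} x_{i₂} ⋯ x_{i_k}`. -/
def apply (A : CubicalTensor ι k) (x : ι → ℂ) (i : ι) : ℂ :=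
  ∑ y : Fin (k - 1) → ι, A i y * ∏ j, x (y j)

/-- `μ` is an eigenvalue of `A` if `A x = μ x^{[k-1]}` for some nonzero complex vector `x`. -/
def IsEigenvalue (A : CubicalTensor ι k) (μ : ℂ) : Prop :=
  ∃ x : ι → ℂ, x ≠ 0 ∧ ∀ i, A.apply x i = μ * x i ^ (k - 1)

/-- The spectral radius: the maximal modulus of the eigenvalues. -/
noncomputable def spectralRadius (A : CubicalTensor ι k) : ℝ :=
  sSup {r : ℝ | ∃ μ : ℂ, A.IsEigenvalue μ ∧ r = ‖μ‖}

end CubicalTensor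

namespace Hypergraph

variable {α : Type*}

/-- Each edge consists of exactly `k` vertices (used for `k ≥ 1`, so that edges are finite). -/
def IsUniform (H : Hypergraph α) (k : ℕ) : Prop :=
  ∀ e ∈ H.edgeSet, e.ncard = k

/-- There is a vertex, and any two vertices are joined by a finite sequence of vertices in which
consecutive ones lie in a common edge. -/
def IsConnected (H : Hypergraph α) : Prop :=
  H.vertexSet.Nonempty ∧
    ∀ u ∈ H.vertexSet, ∀ v ∈ H.vertexSet, Relation.ReflTransGen H.Adj u v

/-- Some proper subset `V₁` of the vertex set meets each edge in an odd number of vertices. -/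
def IsOddBipartite (H : Hypergraph α) : Prop :=
  ∃ V₁ : Set α, V₁ ⊂ H.vertexSet ∧ ∀ e ∈ H.edgeSet, Odd (e ∩ V₁).ncard

open Classical in
/-- The adjacency tensor of a `k`-uniform hypergraph: the entry at `(i₁, …, i_k)` is `1 / (k-1)!`
if `{i₁, …, i_k}` is an edge, and `0` otherwise. As an edge has `k` elements, the indices of a
nonzero entry are distinct. -/
noncomputable def adjacencyTensor (H : Hypergraph α) (k : ℕ) : CubicalTensor H.vertexSet k :=
  fun i y =>
    if insert (i : α) (Set.range fun j => (y j : α)) ∈ H.edgeSet then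
      1 / (Nat.factorial (k - 1) : ℂ)
    else 0

end Hypergraph

/-!
For a `k`-uniform hypergraph with edge family `E`, the eigenvalue equation reads
`∂ᵢ (∑_{e ∈ E} ∏_{j ∈ e} xⱼ) = μ xᵢ ^ (k - 1)`. The spectral radius is `k M`, where `M` is the
maximum of this form on the nonnegative part of the unit `ℓᵏ`-sphere. A maximizer is positive: if
an edge joined a positive entry to a zero entry, raising all entries below `ε` to `ε` would increase
the form by at least a multiple of `ε ^ (k - 1)`, and the sum of `k`-th powers only by a multiple of
`ε ^ k`. Hence the Lagrange condition holds, and it is the eigenvalue equation.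

If `ζ k M` is an eigenvalue for some `ζ` of modulus one, the moduli of an eigenvector form such a
maximizer, so every triangle inequality involved is an equality. Hence its phases `u` satisfy
`∏_{j ∈ e} uⱼ = ζ uᵢ ^ k` for `i ∈ e`, and by connectedness they can be normalized to `k`-th roots
of unity `w` with `∏_{j ∈ e} wⱼ = ζ`; conversely, such `w` turn the positive maximizer into an
eigenvector for `ζ k M`. For `ζ = -1`, raising this equation to the power `k` shows that `k` is
even, and raising it to the power `k / 2`, which is odd, leaves signs `wⱼ ^ (k / 2)` whose product
on each edge is `-1`.
-/

open Finset

section EdgeForm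

variable {V R : Type*}

/-- The polynomial `∑_{e ∈ E} ∏_{j ∈ e} x_j` of a family `E` of finite sets. -/
def edgeForm [CommSemiring R] (E : Finset (Finset V)) (x : V → R) : R :=
  ∑ e ∈ E, ∏ j ∈ e, x j

/-- The partial derivative `∑_{i ∈ e ∈ E} ∏_{j ∈ e, j ≠ i} x_j` of `edgeForm E` at `x`. -/
def edgeGrad [DecidableEq V] [CommSemiring R] (E : Finset (Finset V)) (x : V → R) (i : V) : R :=
  ∑ e ∈ E with i ∈ e, ∏ j ∈ e.erase i, x j

theorem edgeForm_smul [CommSemiring R] {E : Finset (Finset V)} {k : ℕ}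
    (hE : (E : Set (Finset V)).Sized k) (c : R) (x : V → R) :
    edgeForm E (c • x) = c ^ k * edgeForm E x := by
  rw [edgeForm, edgeForm, mul_sum]
  refine sum_congr rfl fun e he => ?_
  simp only [Pi.smul_apply, smul_eq_mul]
  rw [prod_mul_distrib, prod_const, hE he]

theorem edgeForm_nonneg [CommSemiring R] [PartialOrder R] [IsOrderedRing R]
    (E : Finset (Finset V)) {x : V → R} (hx : 0 ≤ x) : 0 ≤ edgeForm E x :=
  sum_nonneg fun _ _ => prod_nonneg fun j _ => hx j

theorem edgeForm_add_prod_le [CommSemiring R] [PartialOrder R] [IsOrderedRing R]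
    {E : Finset (Finset V)} {e : Finset V} (he : e ∈ E) {b : V} (hb : b ∈ e) {x y : V → R}
    (hx : 0 ≤ x) (hxy : x ≤ y) (hxb : x b = 0) :
    edgeForm E x + ∏ j ∈ e, y j ≤ edgeForm E y := by
  classical
  rw [edgeForm, edgeForm, ← add_sum_erase _ _ he, ← add_sum_erase _ _ he, prod_eq_zero hb hxb,
    zero_add, add_comm]
  gcongr
  · exact fun j _ => hx j
  · exact hxy _

theorem continuous_edgeForm (E : Finset (Finset V)) :
    Continuous (edgeForm E : (V → ℝ) → ℝ) := by
  unfold edgeForm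
  fun_prop

variable [DecidableEq V]

theorem mul_edgeGrad [CommSemiring R] (E : Finset (Finset V)) (x : V → R) (i : V) :
    x i * edgeGrad E x i = ∑ e ∈ E with i ∈ e, ∏ j ∈ e, x j := by
  rw [edgeGrad, mul_sum]
  exact sum_congr rfl fun e he => mul_prod_erase e x (mem_filter.1 he).2

theorem sum_mul_edgeGrad [Fintype V] [CommSemiring R] {E : Finset (Finset V)} {k : ℕ}
    (hE : (E : Set (Finset V)).Sized k) (x : V → R) :
    ∑ i, x i * edgeGrad E x i = k * edgeForm E x := by
  simp_rw [mul_edgeGrad, sum_filter]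
  rw [sum_comm, edgeForm, mul_sum]
  refine sum_congr rfl fun e he => ?_
  rw [← sum_filter, filter_univ_mem, sum_const, hE he, nsmul_eq_mul]

theorem edgeForm_update [CommRing R] (E : Finset (Finset V)) (x : V → R) (i : V) (t : R) :
    edgeForm E (Function.update x i t) = edgeForm E x + (t - x i) * edgeGrad E x i := by
  rw [sub_mul, mul_edgeGrad, edgeGrad, mul_sum, edgeForm, edgeForm, sum_filter, sum_filter,
    ← sum_sub_distrib, ← sum_add_distrib]
  refine sum_congr rfl fun e _ => ?_
  by_cases h : i ∈ e
  · simp only [h, if_true]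
    rw [prod_update_of_mem h, sdiff_singleton_eq_erase]
    ring
  · simp only [h, if_false, sub_zero, add_zero]
    exact prod_update_of_notMem h _ _

theorem edgeGrad_mul_of_pow_eq_one [CommSemiring R] {E : Finset (Finset V)} {k : ℕ} (hk : k ≠ 0)
    {w : V → R} {ζ : R} (hw : ∀ i, w i ^ k = 1) (hwE : ∀ e ∈ E, ∏ j ∈ e, w j = ζ)
    (x : V → R) (i : V) :
    edgeGrad E (w * x) i = ζ * w i ^ (k - 1) * edgeGrad E x i := by
  rw [edgeGrad, edgeGrad, mul_sum]
  refine sum_congr rfl fun e he => ?_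
  obtain ⟨he, hi⟩ := mem_filter.1 he
  have hprod : ∏ j ∈ e.erase i, w j = ζ * w i ^ (k - 1) := by
    calc ∏ j ∈ e.erase i, w j = w i ^ (k - 1) * w i * ∏ j ∈ e.erase i, w j := by
          rw [pow_sub_one_mul hk, hw, one_mul]
      _ = ζ * w i ^ (k - 1) := by
          rw [mul_assoc, mul_prod_erase e w hi, hwE e he, mul_comm]
  simp only [Pi.mul_apply]
  rw [prod_mul_distrib, hprod]

theorem hasDerivAt_edgeForm_update (E : Finset (Finset V)) (x : V → ℝ) (i : V) (t : ℝ) :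
    HasDerivAt (fun t => edgeForm E (Function.update x i t)) (edgeGrad E x i) t := by
  simp_rw [edgeForm_update]
  simpa using (((hasDerivAt_id t).sub_const (x i)).mul_const (edgeGrad E x i)).const_add
    (edgeForm E x)

theorem norm_edgeGrad_le (E : Finset (Finset V)) (x : V → ℂ) (i : V) :
    ‖edgeGrad E x i‖ ≤ edgeGrad E (fun j => ‖x j‖) i :=
  (norm_sum_le _ _).trans_eq (sum_congr rfl fun _ _ => norm_prod _ _)

theorem ofReal_edgeGrad (E : Finset (Finset V)) (x : V → ℝ) (i : V) :
    ((edgeGrad E x i : ℝ) : ℂ) = edgeGrad E (fun j => (x j : ℂ)) i := by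
  simp [edgeGrad]

end EdgeForm

theorem hasDerivAt_sum_update_pow {V : Type*} [Fintype V] [DecidableEq V] (x : V → ℝ) (k : ℕ)
    (i : V) (t : ℝ) :
    HasDerivAt (fun t => ∑ j, Function.update x i t j ^ k) (k * t ^ (k - 1)) t := by
  have hsplit : (fun t => ∑ j, Function.update x i t j ^ k) =
      fun t => t ^ k + ∑ j ∈ univ.erase i, x j ^ k := by
    funext t
    rw [← add_sum_erase _ _ (mem_univ i), Function.update_self]
    congr 1
    exact sum_congr rfl fun j hj => by rw [Function.update_of_ne (ne_of_mem_erase hj)]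
  rw [hsplit]
  exact (hasDerivAt_pow k t).add_const _

section NonnegSphere

variable {V : Type*} [Fintype V] {k : ℕ}

variable (V k) in
/-- The nonnegative part of the unit `ℓᵏ`-sphere in `V → ℝ`. -/
def nonnegSphere : Set (V → ℝ) := {x | 0 ≤ x ∧ ∑ i, x i ^ k = 1}

theorem isCompact_nonnegSphere (hk : k ≠ 0) : IsCompact (nonnegSphere V k) := by
  refine isCompact_Icc (a := (0 : V → ℝ)) (b := 1) |>.of_isClosed_subset ?_ ?_
  · exact isClosed_Ici.inter (isClosed_eq (by fun_prop) continuous_const)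
  · rintro x ⟨hx, hsum⟩
    refine ⟨hx, fun i => (pow_le_one_iff_of_nonneg (hx i) hk).1 ?_⟩
    rw [← hsum]
    exact single_le_sum (f := fun i => x i ^ k) (fun j _ => pow_nonneg (hx j) k) (mem_univ i)

theorem nonnegSphere_nonempty [Nonempty V] (hk : k ≠ 0) : (nonnegSphere V k).Nonempty := by
  classical
  obtain ⟨v⟩ := ‹Nonempty V›
  refine ⟨Pi.single v 1, Pi.single_nonneg.2 zero_le_one, ?_⟩
  rw [sum_eq_single v] <;> simp +contextual [hk]

theorem sum_pow_pos {x : V → ℝ} (hx : 0 ≤ x) (hx0 : x ≠ 0) : 0 < ∑ i, x i ^ k := by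
  obtain ⟨v, hv⟩ := Function.ne_iff.1 hx0
  exact sum_pos' (fun i _ => pow_nonneg (hx i) k) ⟨v, mem_univ v, pow_pos ((hx v).lt_of_ne' hv) k⟩

theorem exists_smul_mem_nonnegSphere (hk : k ≠ 0) {x : V → ℝ} (hx : 0 ≤ x) (hx0 : x ≠ 0) :
    ∃ c : ℝ, c • x ∈ nonnegSphere V k := by
  have hs := sum_pow_pos (k := k) hx hx0
  refine ⟨(∑ i, x i ^ k)⁻¹ ^ (k⁻¹ : ℝ), smul_nonneg (by positivity) hx, ?_⟩
  simp_rw [Pi.smul_apply, smul_eq_mul, mul_pow]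
  rw [← mul_sum, Real.rpow_inv_natCast_pow (by positivity) hk, inv_mul_cancel₀ hs.ne']

theorem sum_max_pow_le {x : V → ℝ} (hx : 0 ≤ x) {ε : ℝ} (hε : 0 ≤ ε) :
    ∑ i, max (x i) ε ^ k ≤ ∑ i, x i ^ k + Fintype.card V * ε ^ k := by
  have hpow : ∀ i, max (x i) ε ^ k ≤ x i ^ k + ε ^ k := by
    intro i
    rcases max_choice (x i) ε with h | h <;> rw [h]
    · exact le_add_of_nonneg_right (pow_nonneg hε k)
    · exact le_add_of_nonneg_left (pow_nonneg (hx i) k)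
  simpa [sum_add_distrib] using sum_le_sum fun i (_ : i ∈ univ) => hpow i

end NonnegSphere

/-- Any two points are linked by a chain in which consecutive points lie in a common member of
`E`: connectedness of the hypergraph with vertex set `V` and edge family `E`. -/
def IsLinked {V : Type*} (E : Finset (Finset V)) : Prop :=
  ∀ i j, Relation.ReflTransGen (fun a b => ∃ e ∈ E, a ∈ e ∧ b ∈ e) i j

theorem IsLinked.induction {V : Type*} {E : Finset (Finset V)} (hlink : IsLinked E) {p : V → Prop}
    {i : V} (hi : p i) (hstep : ∀ e ∈ E, ∀ a ∈ e, ∀ b ∈ e, p a → p b) (j : V) :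
    p j := by
  induction hlink i j with
  | refl => exact hi
  | tail _ hab ih =>
    obtain ⟨e, he, ha, hb⟩ := hab
    exact hstep e he _ ha _ hb ih

section Maximum

variable {V : Type*} [Fintype V] {E : Finset (Finset V)} {k : ℕ}

/-- The maximum of `edgeForm E` on the nonnegative part of the unit `ℓᵏ`-sphere. If all members of
`E` have `k` elements, then `k * maxEdgeForm E k` is the largest modulus of an eigenvalue. -/
noncomputable def maxEdgeForm (E : Finset (Finset V)) (k : ℕ) : ℝ :=
  sSup (edgeForm E '' nonnegSphere V k)

/-- A nonzero nonnegative vector at which `edgeForm E x / ∑ x_i ^ k` is maximal. It need not be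
normalized. -/
structure IsEdgeMaximizer (E : Finset (Finset V)) (k : ℕ) (z : V → ℝ) : Prop where
  nonneg : 0 ≤ z
  ne_zero : z ≠ 0
  edgeForm_eq : edgeForm E z = maxEdgeForm E k * ∑ i, z i ^ k

theorem maxEdgeForm_nonneg (E : Finset (Finset V)) (k : ℕ) : 0 ≤ maxEdgeForm E k := by
  refine Real.sSup_nonneg ?_
  rintro _ ⟨x, hx, rfl⟩
  exact edgeForm_nonneg E hx.1

theorem exists_isEdgeMaximizer [Nonempty V] (E : Finset (Finset V)) (hk : k ≠ 0) :
    ∃ z, IsEdgeMaximizer E k z := by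
  obtain ⟨z, hz, hmax⟩ := (isCompact_nonnegSphere hk).exists_sSup_image_eq
    (nonnegSphere_nonempty hk) (continuous_edgeForm E).continuousOn
  refine ⟨z, hz.1, ?_, by rw [hz.2, mul_one, ← hmax, maxEdgeForm]⟩
  rintro rfl
  simpa [hk] using hz.2

theorem edgeForm_le_maxEdgeForm_mul (hk : k ≠ 0) (hE : (E : Set (Finset V)).Sized k) {x : V → ℝ}
    (hx : 0 ≤ x) : edgeForm E x ≤ maxEdgeForm E k * ∑ i, x i ^ k := by
  obtain rfl | hx0 := eq_or_ne x 0
  · rw [← zero_smul ℝ (0 : V → ℝ), edgeForm_smul hE]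
    simp [hk]
  obtain ⟨c, hc⟩ := exists_smul_mem_nonnegSphere hk hx hx0
  have hle : c ^ k * edgeForm E x ≤ maxEdgeForm E k := by
    rw [← edgeForm_smul hE]
    exact le_csSup ((isCompact_nonnegSphere hk).image (continuous_edgeForm E)).bddAbove ⟨_, hc, rfl⟩
  have hsum : c ^ k * ∑ i, x i ^ k = 1 := by
    simpa only [Pi.smul_apply, smul_eq_mul, mul_sum, mul_pow] using hc.2
  calc edgeForm E x = c ^ k * edgeForm E x * ∑ i, x i ^ k := by
        rw [mul_right_comm, hsum, one_mul]
    _ ≤ maxEdgeForm E k * ∑ i, x i ^ k := by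
        gcongr
        exact (sum_pow_pos hx hx0).le

theorem IsEdgeMaximizer.apply_le_mul (hk : k ≠ 0) (hE : (E : Set (Finset V)).Sized k) {z : V → ℝ}
    (hz : IsEdgeMaximizer E k z) {e : Finset V} (he : e ∈ E) {a b : V} (ha : a ∈ e) (hb : b ∈ e)
    (hzb : z b = 0) {ε : ℝ} (hε : 0 < ε) :
    z a ≤ maxEdgeForm E k * Fintype.card V * ε := by
  classical
  let x : V → ℝ := fun j => max (z j) ε
  have hzx : z ≤ x := fun j => le_max_left _ _
  have hx : 0 ≤ x := hz.nonneg.trans hzx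
  have hprod : z a * ε ^ (k - 1) ≤ ∏ j ∈ e, x j := by
    rw [← mul_prod_erase e x ha, ← hE he, ← card_erase_of_mem ha, ← prod_const]
    gcongr
    · exact hzx a
    · exact le_max_right _ _
  have hM := maxEdgeForm_nonneg E k
  have hform : edgeForm E z + z a * ε ^ (k - 1) ≤
      edgeForm E z + maxEdgeForm E k * (Fintype.card V * ε ^ k) := by
    calc edgeForm E z + z a * ε ^ (k - 1) ≤ edgeForm E z + ∏ j ∈ e, x j := by gcongr
      _ ≤ edgeForm E x := edgeForm_add_prod_le he hb hz.nonneg hzx hzb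
      _ ≤ maxEdgeForm E k * ∑ j, x j ^ k := edgeForm_le_maxEdgeForm_mul hk hE hx
      _ ≤ maxEdgeForm E k * (∑ j, z j ^ k + Fintype.card V * ε ^ k) := by
        gcongr
        exact sum_max_pow_le hz.nonneg hε.le
      _ = _ := by rw [mul_add, ← hz.edgeForm_eq]
  rw [← pow_sub_one_mul hk ε] at hform
  exact le_of_mul_le_mul_right (by linarith) (pow_pos hε (k - 1))

theorem IsEdgeMaximizer.pos (hk : k ≠ 0) (hE : (E : Set (Finset V)).Sized k) (hlink : IsLinked E)
    {z : V → ℝ} (hz : IsEdgeMaximizer E k z) (i : V) : 0 < z i := by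
  obtain ⟨v, hv⟩ := Function.ne_iff.1 hz.ne_zero
  refine hlink.induction (p := fun i => 0 < z i) ((hz.nonneg v).lt_of_ne' hv)
    (fun e he a ha b hb hza => ?_) i
  by_contra hzb
  have hzb0 : z b = 0 := le_antisymm (not_lt.1 hzb) (hz.nonneg b)
  have hle : ∀ ε > 0, z a ≤ maxEdgeForm E k * Fintype.card V * ε := fun ε hε =>
    hz.apply_le_mul hk hE he ha hb hzb0 hε
  set C := maxEdgeForm E k * Fintype.card V
  have hC : 0 ≤ C := mul_nonneg (maxEdgeForm_nonneg E k) (Nat.cast_nonneg _)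
  have hlt : C * (z a / (C + 1)) < z a := by
    rw [← mul_div_assoc, div_lt_iff₀ (by positivity)]
    linarith
  exact hlt.not_ge (hle _ (by positivity))

variable [DecidableEq V]

theorem IsEdgeMaximizer.edgeGrad_eq (hk : k ≠ 0) (hE : (E : Set (Finset V)).Sized k) {z : V → ℝ}
    (hz : IsEdgeMaximizer E k z) {i : V} (hi : 0 < z i) :
    edgeGrad E z i = k * maxEdgeForm E k * z i ^ (k - 1) := by
  let φ : ℝ → ℝ := fun t =>
    maxEdgeForm E k * ∑ j, Function.update z i t j ^ k - edgeForm E (Function.update z i t)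
  have hφz : φ (z i) = 0 := by simp [φ, hz.edgeForm_eq]
  have hφ : ∀ t, 0 < t → 0 ≤ φ t := fun t ht =>
    sub_nonneg.2 <| edgeForm_le_maxEdgeForm_mul hk hE <|
      le_update_iff.2 ⟨ht.le, fun j _ => hz.nonneg j⟩
  have hmin : IsLocalMin φ (z i) := by
    filter_upwards [lt_mem_nhds hi] with t ht
    exact hφz.trans_le (hφ t ht)
  have hderiv := hmin.hasDerivAt_eq_zero <|
    ((hasDerivAt_sum_update_pow z k i (z i)).const_mul (maxEdgeForm E k)).sub
      (hasDerivAt_edgeForm_update E z i (z i))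
  linarith

end Maximum

section Eigenvectors

theorem eq_mul_norm_of_sum_eq {ι : Type*} {s : Finset ι} {f : ι → ℂ} {w : ℂ} (hw : ‖w‖ = 1)
    (h : ∑ i ∈ s, f i = w * ((∑ i ∈ s, ‖f i‖ : ℝ) : ℂ)) {i : ι} (hi : i ∈ s) :
    f i = w * ‖f i‖ := by
  have hw0 : w ≠ 0 := norm_ne_zero_iff.1 (by simp [hw])
  have hnorm : ∀ j, ‖w⁻¹ * f j‖ = ‖f j‖ := fun j => by simp [hw]
  have hsum : ∑ j ∈ s, (w⁻¹ * f j).re = ∑ j ∈ s, ‖w⁻¹ * f j‖ := by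
    simp_rw [hnorm]
    rw [← Complex.re_sum, ← mul_sum, h, inv_mul_cancel_left₀ hw0, Complex.ofReal_re]
  have hre := (sum_eq_sum_iff_of_le fun j _ => Complex.re_le_norm _).1 hsum i hi
  have hpos := Complex.eq_coe_norm_of_nonneg (Complex.re_eq_norm.1 hre)
  rwa [hnorm, inv_mul_eq_iff_eq_mul₀ hw0] at hpos

variable {V : Type*} {E : Finset (Finset V)} {k : ℕ}

theorem exists_pow_eq_one_and_prod_eq [Nonempty V] (hE : (E : Set (Finset V)).Sized k)
    (hk : k ≠ 0) (hlink : IsLinked E) {K : Type*} [Field K] {u : V → K} (hu : ∀ i, u i ≠ 0) {ζ : K}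
    (hζ : ζ ≠ 0) (hprod : ∀ e ∈ E, ∀ i ∈ e, ∏ j ∈ e, u j = ζ * u i ^ k) :
    ∃ w : V → K, (∀ i, w i ^ k = 1) ∧ ∀ e ∈ E, ∏ j ∈ e, w j = ζ := by
  obtain ⟨v⟩ := ‹Nonempty V›
  have hconst : ∀ i, u i ^ k = u v ^ k := hlink.induction rfl fun e he a ha b hb hab => by
    rw [← hab]
    exact mul_left_cancel₀ hζ ((hprod e he b hb).symm.trans (hprod e he a ha))
  have hv : u v ^ k ≠ 0 := pow_ne_zero k (hu v)
  refine ⟨fun i => u i / u v, fun i => by rw [div_pow, hconst, div_self hv], fun e he => ?_⟩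
  obtain ⟨i, hi⟩ : e.Nonempty := card_pos.1 (by rw [hE he]; exact hk.bot_lt)
  rw [prod_div_distrib, prod_const, hE he, hprod e he i hi, hconst, mul_div_cancel_right₀ _ hv]

variable [DecidableEq V]

theorem prod_div_norm_eq (hk : k ≠ 0) {x : V → ℂ} (hx0 : ∀ i, x i ≠ 0) {ζ : ℂ} (hζ : ‖ζ‖ = 1)
    {c : ℝ} (hx : ∀ i, edgeGrad E x i = ζ * c * x i ^ (k - 1))
    (hnorm : ∀ i, edgeGrad E (fun j => ‖x j‖) i = c * ‖x i‖ ^ (k - 1))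
    {e : Finset V} (he : e ∈ E) {i : V} (hi : i ∈ e) :
    ∏ j ∈ e, x j / ‖x j‖ = ζ * (x i / ‖x i‖) ^ k := by
  set u : V → ℂ := fun j => x j / ‖x j‖
  have hn0 : ∀ j, (‖x j‖ : ℂ) ≠ 0 := fun j => Complex.ofReal_ne_zero.2 (norm_ne_zero_iff.2 (hx0 j))
  have hu : ∀ j, ‖u j‖ = 1 := fun j => by simp [u, hx0 j]
  have hpow : x i ^ (k - 1) = u i ^ (k - 1) * (‖x i‖ : ℂ) ^ (k - 1) := by
    rw [← mul_pow, div_mul_cancel₀ _ (hn0 i)]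
  have hsum : ∑ f ∈ E with i ∈ f, ∏ j ∈ f.erase i, x j =
      ζ * u i ^ (k - 1) * ((∑ f ∈ E with i ∈ f, ‖∏ j ∈ f.erase i, x j‖ : ℝ) : ℂ) := by
    simp_rw [norm_prod]
    change edgeGrad E x i = _ * ((edgeGrad E (fun j => ‖x j‖) i : ℝ) : ℂ)
    rw [hnorm, hx, hpow]
    push_cast
    ring
  have hterm := eq_mul_norm_of_sum_eq (by simp [hζ, hu]) hsum (mem_filter.2 ⟨he, hi⟩)
  have herase : ∏ j ∈ e.erase i, u j = ζ * u i ^ (k - 1) := by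
    rw [prod_div_distrib, hterm, norm_prod, Complex.ofReal_prod]
    exact mul_div_cancel_right₀ _ (prod_ne_zero_iff.2 fun j _ => hn0 j)
  rw [← mul_prod_erase e u hi, herase, ← pow_sub_one_mul hk]
  ring

variable [Fintype V]

theorem norm_mul_sum_norm_pow_le (hk : k ≠ 0) (hE : (E : Set (Finset V)).Sized k) {x : V → ℂ}
    {μ : ℂ} (hx : ∀ i, edgeGrad E x i = μ * x i ^ (k - 1)) :
    ‖μ‖ * ∑ i, ‖x i‖ ^ k ≤ k * edgeForm E fun i => ‖x i‖ := by
  rw [← sum_mul_edgeGrad hE, mul_sum]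
  refine sum_le_sum fun i _ => ?_
  calc ‖μ‖ * ‖x i‖ ^ k = ‖x i‖ * ‖edgeGrad E x i‖ := by
        rw [hx, norm_mul, norm_pow, ← pow_sub_one_mul hk]
        ring
    _ ≤ _ := by
        gcongr
        exact norm_edgeGrad_le E x i

theorem norm_le_mul_maxEdgeForm (hk : k ≠ 0) (hE : (E : Set (Finset V)).Sized k) {x : V → ℂ}
    (hx0 : x ≠ 0) {μ : ℂ} (hx : ∀ i, edgeGrad E x i = μ * x i ^ (k - 1)) :
    ‖μ‖ ≤ k * maxEdgeForm E k := by
  have hnorm0 : (fun i => ‖x i‖) ≠ 0 := fun h => hx0 (funext fun i => norm_eq_zero.1 (congrFun h i))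
  have hnorm : 0 ≤ fun i => ‖x i‖ := fun i => norm_nonneg _
  refine le_of_mul_le_mul_right ?_ (sum_pow_pos (k := k) hnorm hnorm0)
  refine (norm_mul_sum_norm_pow_le hk hE hx).trans ?_
  rw [mul_assoc]
  gcongr
  exact edgeForm_le_maxEdgeForm_mul hk hE hnorm

theorem isEdgeMaximizer_norm (hk : k ≠ 0) (hE : (E : Set (Finset V)).Sized k) {x : V → ℂ}
    (hx0 : x ≠ 0) {μ : ℂ} (hx : ∀ i, edgeGrad E x i = μ * x i ^ (k - 1))
    (hμ : ‖μ‖ = k * maxEdgeForm E k) : IsEdgeMaximizer E k fun i => ‖x i‖ where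
  nonneg i := norm_nonneg _
  ne_zero h := hx0 (funext fun i => norm_eq_zero.1 (congrFun h i))
  edgeForm_eq := by
    refine (edgeForm_le_maxEdgeForm_mul hk hE fun i => norm_nonneg _).antisymm ?_
    have hle := norm_mul_sum_norm_pow_le hk hE hx
    rw [hμ, mul_assoc] at hle
    exact le_of_mul_le_mul_left hle (by positivity)

theorem exists_edgeGrad_eq_iff [Nonempty V] (hk : k ≠ 0) (hE : (E : Set (Finset V)).Sized k)
    (hlink : IsLinked E) {ζ : ℂ} (hζ : ‖ζ‖ = 1) :
    (∃ x : V → ℂ, x ≠ 0 ∧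
        ∀ i, edgeGrad E x i = ζ * ((k * maxEdgeForm E k : ℝ) : ℂ) * x i ^ (k - 1)) ↔
      ∃ w : V → ℂ, (∀ i, w i ^ k = 1) ∧ ∀ e ∈ E, ∏ j ∈ e, w j = ζ := by
  constructor
  · rintro ⟨x, hx0, hx⟩
    have hM : 0 ≤ k * maxEdgeForm E k := mul_nonneg (Nat.cast_nonneg k) (maxEdgeForm_nonneg E k)
    have hmax := isEdgeMaximizer_norm hk hE hx0 hx (by
      rw [norm_mul, hζ, one_mul, Complex.norm_of_nonneg hM])
    have hpos := hmax.pos hk hE hlink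
    have hne : ∀ i, x i ≠ 0 := fun i => norm_pos_iff.1 (hpos i)
    refine exists_pow_eq_one_and_prod_eq hE hk hlink (u := fun i => x i / ‖x i‖) (fun i => ?_) ?_
      fun e he i hi => prod_div_norm_eq hk hne hζ hx
        (fun j => hmax.edgeGrad_eq hk hE (hpos j)) he hi
    · exact div_ne_zero (hne i) (Complex.ofReal_ne_zero.2 (hpos i).ne')
    · exact norm_ne_zero_iff.1 (by simp [hζ])
  · rintro ⟨w, hw, hwE⟩
    obtain ⟨z, hz⟩ := exists_isEdgeMaximizer E hk
    have hpos := hz.pos hk hE hlink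
    have hw0 : ∀ i, w i ≠ 0 := fun i h => by simpa [h, hk] using hw i
    obtain ⟨v⟩ := ‹Nonempty V›
    refine ⟨w * fun i => (z i : ℂ), fun h => ?_, fun i => ?_⟩
    · exact mul_ne_zero (hw0 v) (Complex.ofReal_ne_zero.2 (hpos v).ne') (congrFun h v)
    · rw [edgeGrad_mul_of_pow_eq_one hk hw hwE, ← ofReal_edgeGrad, hz.edgeGrad_eq hk hE (hpos i),
        Pi.mul_apply, mul_pow]
      push_cast
      ring

end Eigenvectors

section RootsOfUnity

variable {V R : Type*} [CommRing R] {E : Finset (Finset V)} {k : ℕ} {w : V → R}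

theorem prod_ite_neg_one [DecidableEq V] (e S : Finset V) :
    ∏ j ∈ e, (if j ∈ S then (-1 : R) else 1) = (-1) ^ #(e ∩ S) := by
  rw [prod_ite, prod_const, prod_const_one, mul_one, filter_mem_eq_inter]

theorem even_of_prod_eq_neg_one (hR : (-1 : R) ≠ 1) (hw : ∀ i, w i ^ k = 1) {e : Finset V}
    (hwe : ∏ j ∈ e, w j = -1) : Even k := by
  by_contra hodd
  refine hR ?_
  rw [← (Nat.not_even_iff_odd.1 hodd).neg_one_pow, ← hwe, ← prod_pow]
  exact prod_eq_one fun j _ => hw j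

theorem exists_odd_card_inter_of_prod_eq_neg_one [DecidableEq V] [NoZeroDivisors R]
    (hR : (-1 : R) ≠ 1) {m : ℕ} (hm : Odd m) (hw : ∀ i, w i ^ (2 * m) = 1)
    (hwE : ∀ e ∈ E, ∏ j ∈ e, w j = -1) : ∃ S : Finset V, ∀ e ∈ E, Odd #(e ∩ S) := by
  classical
  let S : Finset V := {i ∈ E.biUnion id | w i ^ m = -1}
  have hsign : ∀ e ∈ E, ∀ i ∈ e, w i ^ m = if i ∈ S then -1 else 1 := by
    intro e he i hi
    have hmem : i ∈ E.biUnion id := mem_biUnion.2 ⟨e, he, hi⟩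
    have hsq : w i ^ m * w i ^ m = 1 := by rw [← pow_add, ← two_mul, hw]
    rcases mul_self_eq_one_iff.1 hsq with h | h
    · rw [h, if_neg fun hS => hR (h ▸ (mem_filter.1 hS).2).symm]
    · rw [h, if_pos (mem_filter.2 ⟨hmem, h⟩)]
  refine ⟨S, fun e he => ?_⟩
  have hpow : (-1 : R) ^ #(e ∩ S) = -1 := by
    rw [← prod_ite_neg_one, ← prod_congr rfl (hsign e he), prod_pow, hwE e he, hm.neg_one_pow]
  by_contra hodd
  rw [(Nat.not_odd_iff_even.1 hodd).neg_one_pow] at hpow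
  exact hR hpow.symm

theorem exists_prod_eq_neg_one_iff [DecidableEq V] [NoZeroDivisors R]
    (hR : (-1 : R) ≠ 1) (hk4 : ¬ 4 ∣ k) (hne : E.Nonempty) :
    (∃ w : V → R, (∀ i, w i ^ k = 1) ∧ ∀ e ∈ E, ∏ j ∈ e, w j = -1) ↔
      Even k ∧ ∃ S : Finset V, ∀ e ∈ E, Odd #(e ∩ S) := by
  constructor
  · rintro ⟨w, hw, hwE⟩
    obtain ⟨e, he⟩ := hne
    have heven := even_of_prod_eq_neg_one hR hw (hwE e he)
    obtain ⟨m, rfl⟩ := heven.two_dvd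
    have hm : Odd m := by
      rw [← Nat.not_even_iff_odd]
      rintro ⟨n, rfl⟩
      exact hk4 ⟨n, by ring⟩
    exact ⟨heven, exists_odd_card_inter_of_prod_eq_neg_one hR hm hw hwE⟩
  · rintro ⟨heven, S, hS⟩
    refine ⟨fun j => if j ∈ S then -1 else 1, fun i => ?_, fun e he => ?_⟩
    · dsimp only
      split_ifs
      · exact heven.neg_one_pow
      · exact one_pow k
    · rw [prod_ite_neg_one, (hS e he).neg_one_pow]

end RootsOfUnity

section Enumeration

variable {ι V : Type*} [Fintype ι] [DecidableEq V]

theorem insert_image_eq_iff {e : Finset V} {i : V} (hi : i ∈ e)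
    (he : Fintype.card ι < #e) (y : ι → V) :
    insert i (univ.image y) = e ↔ univ.image y = e.erase i := by
  constructor
  · rintro rfl
    have hnotMem : i ∉ univ.image y := fun h => by
      rw [insert_eq_of_mem h] at he
      exact he.not_ge card_image_le
    rw [erase_insert hnotMem]
  · intro h
    rw [h, insert_erase hi]

theorem sum_prod_comp_of_image_eq [Fintype V] [DecidableEq ι] {R : Type*} [CommSemiring R]
    {s : Finset V} (hs : #s = Fintype.card ι) (x : V → R) :
    ∑ y : ι → V with univ.image y = s, ∏ j, x (y j) = (#s).factorial * ∏ j ∈ s, x j := by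
  have hcard : Fintype.card ι = Fintype.card s := by rw [Fintype.card_coe, hs]
  have hequiv : ∑ y : ι → V with univ.image y = s, ∏ j, x (y j) =
      ∑ σ : ι ≃ s, ∏ j, x (σ j) := by
    symm
    refine sum_nbij (fun σ j => (σ j : V)) (fun σ _ => ?_) (fun σ _ τ _ h => ?_) (fun y hy => ?_)
      fun _ _ => rfl
    · rw [mem_filter_univ]
      change univ.image (Subtype.val ∘ σ) = s
      rw [← image_image, image_univ_of_surjective σ.surjective, univ_eq_attach, attach_image_val]
    · exact Equiv.ext fun j => Subtype.ext (congrFun h j)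
    · have himage : univ.image y = s := by simpa using hy
      have hmem : ∀ j, y j ∈ s := fun j => himage ▸ mem_image_of_mem y (mem_univ j)
      have hsurj : Function.Surjective fun j => (⟨y j, hmem j⟩ : s) := by
        rintro ⟨v, hv⟩
        obtain ⟨j, -, rfl⟩ := mem_image.1 (himage ▸ hv)
        exact ⟨j, rfl⟩
      have hbij := (Fintype.bijective_iff_surjective_and_card _).2 ⟨hsurj, hcard⟩
      exact ⟨Equiv.ofBijective _ hbij, mem_univ _, rfl⟩
  have hprod : ∀ σ : ι ≃ s, ∏ j, x (σ j) = ∏ j ∈ s, x j := fun σ => by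
    rw [σ.prod_comp fun l => x l, prod_coe_sort s x]
  simp_rw [hequiv, hprod]
  rw [sum_const, card_univ, Fintype.card_equiv (Fintype.equivOfCardEq hcard), ← hs, nsmul_eq_mul]

end Enumeration

section Hypergraphs

variable {α : Type*} {H : Hypergraph α} [Fintype H.vertexSet] {k : ℕ}

open Classical in
variable (H) in
/-- The edges of `H` as finite sets of elements of the subtype of vertices, which indexes the
adjacency tensor. -/
noncomputable def edgeFamily : Finset (Finset H.vertexSet) :=
  {e | Subtype.val '' (e : Set H.vertexSet) ∈ H.edgeSet}

theorem mem_edgeFamily {e : Finset H.vertexSet} :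
    e ∈ edgeFamily H ↔ Subtype.val '' (e : Set H.vertexSet) ∈ H.edgeSet := by
  simp [edgeFamily]

theorem exists_mem_edgeFamily_image_eq {e : Set α} (he : e ∈ H.edgeSet) :
    ∃ f ∈ edgeFamily H, Subtype.val '' (f : Set H.vertexSet) = e := by
  classical
  have himage : Subtype.val ''
      ((Subtype.val ⁻¹' e : Set H.vertexSet).toFinset : Set H.vertexSet) = e := by
    rw [Set.coe_toFinset, Subtype.image_preimage_coe]
    exact Set.inter_eq_right.2 (H.subset_vertexSet_of_mem_edgeSet he)
  exact ⟨_, mem_edgeFamily.2 (himage.symm ▸ he), himage⟩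

theorem edgeFamily_nonempty (hedge : H.edgeSet.Nonempty) : (edgeFamily H).Nonempty := by
  obtain ⟨e, he⟩ := hedge
  obtain ⟨f, hf, -⟩ := exists_mem_edgeFamily_image_eq he
  exact ⟨f, hf⟩

theorem sized_edgeFamily (hunif : H.IsUniform k) :
    (edgeFamily H : Set (Finset H.vertexSet)).Sized k := fun e he => by
  rw [← hunif _ (mem_edgeFamily.1 he), Set.ncard_image_of_injective _ Subtype.val_injective,
    Set.ncard_coe_finset]

theorem isLinked_edgeFamily (hconn : H.IsConnected) : IsLinked (edgeFamily H) := by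
  intro i j
  suffices ∀ v, Relation.ReflTransGen H.Adj i v → ∃ hv : v ∈ H.vertexSet,
      Relation.ReflTransGen (fun a b => ∃ e ∈ edgeFamily H, a ∈ e ∧ b ∈ e) i ⟨v, hv⟩ from
    (this j (hconn.2 i i.2 j j.2)).2
  intro v hv
  induction hv with
  | refl => exact ⟨i.2, .refl⟩
  | tail _ hab ih =>
    obtain ⟨ha, hchain⟩ := ih
    obtain ⟨e, he, hae, hbe⟩ := hab
    have hb := H.mem_vertexSet_of_mem_edgeSet he hbe
    obtain ⟨f, hf, rfl⟩ := exists_mem_edgeFamily_image_eq he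
    exact ⟨hb, hchain.tail ⟨f, hf, by simpa [ha] using hae, by simpa [hb] using hbe⟩⟩

theorem insert_range_mem_edgeSet_iff [DecidableEq H.vertexSet] {ι : Type*} [Fintype ι]
    (i : H.vertexSet) (y : ι → H.vertexSet) :
    insert (i : α) (Set.range fun j => (y j : α)) ∈ H.edgeSet ↔
      insert i (univ.image y) ∈ edgeFamily H := by
  rw [mem_edgeFamily, coe_insert, coe_image, coe_univ, Set.image_univ, Set.image_insert_eq,
    ← Set.range_comp]
  rfl

theorem isOddBipartite_iff [DecidableEq H.vertexSet] (hk : Even k) (hunif : H.IsUniform k)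
    (hedge : H.edgeSet.Nonempty) :
    H.IsOddBipartite ↔ ∃ S : Finset H.vertexSet, ∀ e ∈ edgeFamily H, Odd #(e ∩ S) := by
  have hcard : ∀ e S : Finset H.vertexSet,
      (Subtype.val '' (e : Set H.vertexSet) ∩ Subtype.val '' (S : Set H.vertexSet)).ncard =
        #(e ∩ S) := by
    intro e S
    rw [← Set.image_inter Subtype.val_injective,
      Set.ncard_image_of_injective _ Subtype.val_injective, ← coe_inter, Set.ncard_coe_finset]
  constructor
  · classical
    rintro ⟨V₁, hV₁, hodd⟩
    refine ⟨(Subtype.val ⁻¹' V₁ : Set H.vertexSet).toFinset, fun e he => ?_⟩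
    rw [← hcard, Set.coe_toFinset, Subtype.image_preimage_coe, Set.inter_eq_right.2 hV₁.subset]
    exact hodd _ (mem_edgeFamily.1 he)
  · rintro ⟨S, hS⟩
    have hodd : ∀ e ∈ H.edgeSet, Odd (e ∩ Subtype.val '' (S : Set H.vertexSet)).ncard := by
      intro e he
      obtain ⟨f, hf, rfl⟩ := exists_mem_edgeFamily_image_eq he
      rw [hcard]
      exact hS f hf
    -- The whole vertex set meets every edge in `k` vertices, an even number.
    refine ⟨_, (Subtype.coe_image_subset _ _).ssubset_of_ne fun htop => ?_, hodd⟩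
    obtain ⟨e, he⟩ := hedge
    have hodd_k := hodd e he
    rw [htop, Set.inter_eq_left.2 (H.subset_vertexSet_of_mem_edgeSet he), hunif e he] at hodd_k
    exact Nat.not_odd_iff_even.2 hk hodd_k

theorem adjacencyTensor_apply [DecidableEq H.vertexSet] (hunif : H.IsUniform k)
    (x : H.vertexSet → ℂ) (i : H.vertexSet) :
    (H.adjacencyTensor k).apply x i = edgeGrad (edgeFamily H) x i := by
  have hentry : ∀ y : Fin (k - 1) → H.vertexSet, H.adjacencyTensor k i y =
      ∑ e ∈ edgeFamily H with i ∈ e,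
        if insert i (univ.image y) = e then ((k - 1).factorial : ℂ)⁻¹ else 0 := by
    intro y
    rw [sum_ite_eq]
    simp [Hypergraph.adjacencyTensor, insert_range_mem_edgeSet_iff]
  simp_rw [CubicalTensor.apply, hentry, sum_mul, ite_mul, zero_mul]
  rw [sum_comm, edgeGrad]
  refine sum_congr rfl fun e he => ?_
  obtain ⟨he, hi⟩ := mem_filter.1 he
  have hcard : #(e.erase i) = k - 1 := by rw [card_erase_of_mem hi, sized_edgeFamily hunif he]
  have hlt : Fintype.card (Fin (k - 1)) < #e := by
    rw [Fintype.card_fin, ← hcard]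
    exact card_erase_lt_of_mem hi
  simp_rw [insert_image_eq_iff hi hlt]
  rw [← sum_filter, ← mul_sum, sum_prod_comp_of_image_eq (by rw [hcard, Fintype.card_fin]), hcard,
    inv_mul_cancel_left₀ (Nat.cast_ne_zero.2 (Nat.factorial_ne_zero _))]

theorem isEigenvalue_adjacencyTensor_iff [DecidableEq H.vertexSet] (hunif : H.IsUniform k)
    {μ : ℂ} :
    (H.adjacencyTensor k).IsEigenvalue μ ↔
      ∃ x : H.vertexSet → ℂ, x ≠ 0 ∧ ∀ i, edgeGrad (edgeFamily H) x i = μ * x i ^ (k - 1) := by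
  simp only [CubicalTensor.IsEigenvalue, adjacencyTensor_apply hunif]

theorem spectralRadius_adjacencyTensor (hk : k ≠ 0) (hunif : H.IsUniform k)
    (hconn : H.IsConnected) :
    (H.adjacencyTensor k).spectralRadius = k * maxEdgeForm (edgeFamily H) k := by
  classical
  have : Nonempty H.vertexSet := hconn.1.to_subtype
  have hE := sized_edgeFamily hunif
  have hM : 0 ≤ k * maxEdgeForm (edgeFamily H) k :=
    mul_nonneg (Nat.cast_nonneg k) (maxEdgeForm_nonneg _ k)
  have hperron : (H.adjacencyTensor k).IsEigenvalue (k * maxEdgeForm (edgeFamily H) k : ℝ) := by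
    rw [isEigenvalue_adjacencyTensor_iff hunif, ← one_mul (Complex.ofReal _),
      exists_edgeGrad_eq_iff hk hE (isLinked_edgeFamily hconn) norm_one]
    exact ⟨1, fun _ => one_pow k, fun _ _ => prod_const_one⟩
  refine IsGreatest.csSup_eq ⟨⟨_, hperron, (Complex.norm_of_nonneg hM).symm⟩, ?_⟩
  rintro _ ⟨μ, hμ, rfl⟩
  obtain ⟨x, hx0, hx⟩ := (isEigenvalue_adjacencyTensor_iff hunif).1 hμ
  exact norm_le_mul_maxEdgeForm hk hE hx0 hx

theorem isEigenvalue_mul_spectralRadius_iff (hk : k ≠ 0) (hunif : H.IsUniform k)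
    (hconn : H.IsConnected) {ζ : ℂ} (hζ : ‖ζ‖ = 1) :
    (H.adjacencyTensor k).IsEigenvalue (ζ * (H.adjacencyTensor k).spectralRadius) ↔
      ∃ w : H.vertexSet → ℂ, (∀ i, w i ^ k = 1) ∧ ∀ e ∈ edgeFamily H, ∏ j ∈ e, w j = ζ := by
  classical
  have : Nonempty H.vertexSet := hconn.1.to_subtype
  rw [isEigenvalue_adjacencyTensor_iff hunif, spectralRadius_adjacencyTensor hk hunif hconn,
    exists_edgeGrad_eq_iff hk (sized_edgeFamily hunif) (isLinked_edgeFamily hconn) hζ]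

end Hypergraphs

theorem theorem3p5 {α : Type*} (H : Hypergraph α) [Fintype H.vertexSet] (k : ℕ) (hk : 2 ≤ k)
    (hk4 : ¬ 4 ∣ k) (hunif : H.IsUniform k) (hconn : H.IsConnected)
    (hedge : H.edgeSet.Nonempty) :
    (Even k ∧ H.IsOddBipartite) ↔
      (H.adjacencyTensor k).IsEigenvalue (-((H.adjacencyTensor k).spectralRadius : ℂ)) := by
  classical
  have hk0 : k ≠ 0 := by omega
  have hneg : (-1 : ℂ) ≠ 1 := by norm_num
  rw [← neg_one_mul, isEigenvalue_mul_spectralRadius_iff hk0 hunif hconn (by simp),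
    exists_prod_eq_neg_one_iff hneg hk4 (edgeFamily_nonempty hedge)]
  exact and_congr_right fun heven => isOddBipartite_iff heven hunif hedge
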